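/- Theorem 4.1. Let $a,b\in\mathbb{C}$ and $p,q\in\mathbb{R}$ be such that \[ C:\ c(z)=\overline{a}z^2+pz\overline{z}+a\overline{z}^2+\overline{b}z+b\overline{z}+q=0 \] is a non-degenerate conic (an ellipse, possibly a circle, a hyperbola or a parabola); that is, $C$ is non-empty and \[ \det\begin{pmatrix}\overline{a}&p/2&\overline{b}/2\\ p/2&a&b/2\\ \overline{b}/2&b/2&q\end{pmatrix}\neq 0 . \] For $r>2$ put $r_2=r^2/2$ and let \[ E:\ e(z)=z^2+(2-2r_2)z\overline{z}+\overline{z}^2+r_2^2-2r_2=0, \] the ellipse $|z-1|+|z+1|=r$ with foci $\pm1$. Suppose that, for some $r>2$, the ellipse $E$ does not coincide with $C$ and is tangent to $C$ at a point $z\in\mathbb{C}$, i.e. $z$ lies on both curves, both are regular there, and their tangent lines at $z$ coincide. Then $z$ is a root of the polynomial (of degree at most $6$) \[ F_4=W_6z^6+W_5z^5+W_4z^4+W_3z^3+W_2z^2+W_1z+W_0, \] where \begin{align*} W_6&=4\overline{a}(\overline{b}bp-\overline{b}^2a -\overline{a}b^2)(p^2-4\overline{a}a),\\ W_5&= -2\Big[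 bp^5-\overline{b}(a+\overline{a})p^4-b(4\overline{a}q+8\overline{a}a +\overline{b}^2)p^3 +\overline{b}\big( 8\overline{a}aq+8\overline{a}a^2 +(8\overline{a}^2+\overline{b}^2)a \\* & -3\overline{a}b^2\big)p^2 +4\overline{a}b(4\overline{a}aq+4\overline{a}a^2+4\overline{b}^2a +\overline{a}b^2)p-4a\overline{a}\overline{b} \big( 8\overline{a}aq +4\overline{a}a^2\\* & +(4\overline{a}^2+3\overline{b}^2)a+3\overline{a}b^2 \big)\Big],\\ W_4&=-\Big[p^6-\big( (4a+4\overline{a})q+a^2+10\overline{a}a-9b^2+\overline{a}^2 +\overline{b}^2\big)p^4-2b\overline{b}(2q+11a+\overline{a})p^3 \\* & +\Big(16\overline{a}aq^2+4\big( 8\overline{a}a^2+(8\overline{a}^2+2\overline{b}^2)a -5\overline{a}b^2\big)q +8\overline{a}a^3+(32\overline{a}^2+14\overline{b}^2)a^2 \\* & +(-42\overline{a}b^2+8\overline{a}^3+18\overline{b}^2\overline{a})a +(-6\overline{a}^2-5\overline{b}^2)b^2\Big)p^2 +2b\overline{b}\big( 48\overline{a}aq+44\overline{a}a^2 \\* &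 +(4\overline{a}^2+7\overline{b}^2)a +\overline{a}b^2\big)p -64\overline{a}^2a^2q^2-16a^2\overline{a}(4\overline{a}a+4\overline{a}^2 +7\overline{b}^2)q -16\overline{a}^2a^4-(32\overline{a}^3 \\* & +56\overline{b}^2\overline{a})a^3 +(24\overline{a}^2b^2-16\overline{a}^4 -56\overline{b}^2\overline{a}^2-9\overline{b}^4)a^2+(24\overline{a}^3 -6\overline{b}^2\overline{a})b^2a+3\overline{a}^2b^4\Big],\\ W_3&= -2\Big[ 2bp^5-\overline{b}(q+4a)p^4-b\big((14a+2\overline{a})q+2a^2 +12\overline{a}a -8b^2+2\overline{a}^2+\overline{b}^2\big)p^3 \\* & +\overline{b}\big(4aq^2+(20a^2 +20\overline{a}a-7b^2)q+4a^3+24\overline{a}a^2 +(-24b^2+4\overline{a}^2+3\overline{b}^2)a-\overline{a}b^2\big)p^2 \\* & +b\Big(32\overline{a}aq^2+\big(56\overline{a}a^2+(8\overline{a}^2 +26\overline{b}^2)a-6\overline{a}b^2\big)q+8\overline{a}a^3 +(16\overline{a}^2+26\overline{b}^2)a^2\\* & +(-18\overline{a}b^2 +8\overline{a}^3+2\overline{b}^2\overline{a})a+(-6\overline{a}^2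 -\overline{b}^2)b^2\Big)p -\overline{b}\Big(80\overline{a}a^2q^2+4a\big(20\overline{a}a^2 \\* & +(16\overline{a}^2+6\overline{b}^2)a -3\overline{a}b^2\big)q+16\overline{a}a^4 +(32\overline{a}^2+12\overline{b}^2)a^3 +(-28\overline{a}b^2+16\overline{a}^3+16\overline{b}^2\overline{a})a^2 \\* & +(-24\overline{a}^2-\overline{b}^2)b^2a-\overline{a}b^4\Big)\Big], \\ W_2&= 2\Big[\big( (3a-\overline{a})q-3b^2 \big)p^4 +b\overline{b}(3q+9a+\overline{a})p^3 +\Big(-2(6a^2+2\overline{a}a-b^2)q^2 -\big(4a^3 \\* & +16\overline{a}a^2 +(-27b^2-4\overline{a}^2+9\overline{b}^2)a +4\overline{a}b^2\big)q+3(b^2-3\overline{b}^2)a^2 +(9\overline{a}b^2-\overline{b}^2\overline{a})a-7b^4\\* & +2\overline{a}^2b^2\Big)p^2 -b\overline{b}\big(28aq^2+(60a^2-5b^2)q+8a^3+20\overline{a}a^2-(19b^2 -12\overline{a}^2)a-5\overline{a}b^2\big)p \\* & +32\overline{a}a^2q^3 +4a\big(12\overline{a}a^2+(4\overline{a}^2+11\overline{b}^2)a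 -3\overline{a}b^2\big)q^2 +\big(16\overline{a}a^4+(16\overline{a}^2 +44\overline{b}^2)a^3\\* & +(-32\overline{a}b^2+40\overline{b}^2\overline{a})a^2 -(12\overline{a}^2+9\overline{b}^2)b^2a+\overline{a}b^4\big)q +8\overline{b}^2a^4+(-4\overline{a}b^2+20\overline{b}^2\overline{a})a^3 \\* & +\big(-(4\overline{a}^2+15\overline{b}^2)b^2+12\overline{b}^2\overline{a}^2 +3\overline{b}^4\big)a^2 +(5\overline{a}b^4-15\overline{b}^2\overline{a}b^2)a +2\overline{a}^2b^4\Big],\\ W_1&=2\Big[2b\big(q^2+(3a-\overline{a})q-b^2\big)p^3 -\overline{b}\big(8aq^2+(12a^2 -4\overline{a}a+b^2)q-6b^2a-2\overline{a}b^2\big)p^2\\* & -b\Big(8aq^3+(32a^2 -8\overline{a}a-2b^2)q^2+\big(8a^3+8\overline{a}a^2 +(-20b^2-2\overline{b}^2)a +2\overline{a}b^2\big)q \\* & +(-2b^2+6\overline{b}^2)a^2+(-2\overline{a}b^2 +6\overline{b}^2\overline{a})a+3b^4-\overline{b}^2b^2\Big)p +\overline{b}\Big(32a^2q^3\\* & +4a(12a^2+4\overline{a}a-3b^2)q^2+\big(16a^4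 +16\overline{a}a^3+(-32b^2+8\overline{b}^2)a^2 -12\overline{a}b^2a+b^4\big)q\\* & +(-4b^2+4\overline{b}^2)a^3+(-4\overline{a}b^2 +4\overline{b}^2\overline{a})a^2+(5b^4-3\overline{b}^2b^2)a +2\overline{a}b^4\Big)\Big],\\ W_0 & =q^2p^4-2\overline{b}bqp^3 +\big(-8aq^3+(-8a^2+2b^2)q^2+(6b^2+2\overline{b}^2)aq -b^4+\overline{b}^2b^2\big)p^2\\* & +2b\overline{b}\big(4aq^2+(-4a^2-b^2)q+(b^2 -\overline{b}^2)a\big)p +16a^2q^4+8a(4a^2-b^2)q^3\\* & +\big(16a^4+(-32b^2+8\overline{b}^2)a^2+b^4\big)q^2 -2a\big((4b^2-4\overline{b}^2)a^2-5b^4+3\overline{b}^2b^2\big)q \\* & +(b-\overline{b})(b+\overline{b})\big((b^2-\overline{b}^2)a^2-b^4\big). \end{align*} -/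

import Mathlib

open scoped ComplexConjugate

noncomputable section

namespace Alhazen

/-- The left-hand side `c(z) = ā z² + p z z̄ + a z̄² + b̄ z + b z̄ + q` of the equation of a conic.
Its values are real (see `conicFun_coe`), so it is recorded as a function into `ℝ`. -/
def conicFun (a b : ℂ) (p q : ℝ) (z : ℂ) : ℝ :=
  (conj a * z ^ 2 + p * z * conj z + a * conj z ^ 2 + conj b * z + b * conj z + q).re

theorem conicFun_coe (a b : ℂ) (p q : ℝ) (z : ℂ) :
    (conicFun a b p q z : ℂ) =
      conj a * z ^ 2 + p * z * conj z + a * conj z ^ 2 + conj b * z + b * conj z + q := by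
  unfold conicFun
  rw [← Complex.conj_eq_iff_re]
  simp only [map_add, map_mul, map_pow, Complex.conj_conj, Complex.conj_ofReal]
  ring

/-- The conic `C : c(z) = 0`. -/
def conic (a b : ℂ) (p q : ℝ) : Set ℂ := {z | conicFun a b p q z = 0}

/-- `C` is a non-degenerate conic (an ellipse, possibly a circle, a hyperbola or a parabola):
the symmetric matrix of the quadratic form `c` in the homogeneous coordinates `(z, z̄, 1)` is
regular, and `C` has a (real) point. -/
def IsNondegenerateConic (a b : ℂ) (p q : ℝ) : Prop :=
  Matrix.det !![conj a, (p : ℂ) / 2, conj b / 2;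
                (p : ℂ) / 2, a, b / 2;
                conj b / 2, b / 2, (q : ℂ)] ≠ 0 ∧
  (conic a b p q).Nonempty

/-- The left-hand side `e(z) = z² + (2 - 2 r₂) z z̄ + z̄² + r₂² - 2 r₂`, where `r₂ = r² / 2`, of the
equation of the ellipse `|z - 1| + |z + 1| = r` (`r > 2`). Its values are real (see
`ellipseFun_coe`), so it is recorded as a function into `ℝ`. -/
def ellipseFun (r : ℝ) (z : ℂ) : ℝ :=
  (z ^ 2 + (2 - 2 * ((r ^ 2 / 2 : ℝ) : ℂ)) * z * conj z + conj z ^ 2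
    + ((r ^ 2 / 2 : ℝ) : ℂ) ^ 2 - 2 * ((r ^ 2 / 2 : ℝ) : ℂ)).re

theorem ellipseFun_coe (r : ℝ) (z : ℂ) :
    (ellipseFun r z : ℂ) =
      z ^ 2 + (2 - 2 * ((r ^ 2 / 2 : ℝ) : ℂ)) * z * conj z + conj z ^ 2
        + ((r ^ 2 / 2 : ℝ) : ℂ) ^ 2 - 2 * ((r ^ 2 / 2 : ℝ) : ℂ) := by
  unfold ellipseFun
  rw [← Complex.conj_eq_iff_re]
  simp only [map_add, map_sub, map_mul, map_pow, Complex.conj_conj, Complex.conj_ofReal,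
    map_ofNat]
  ring

/-- The ellipse `E : e(z) = 0` with foci `1` and `-1`. -/
def confocalEllipse (r : ℝ) : Set ℂ := {z | ellipseFun r z = 0}

/-- The curves `f = 0` and `g = 0` in the plane `ℂ = ℝ²` are tangent at `z`: the point `z` lies on
both of them, both are regular there, and their tangent lines at `z`, whose directions are the
kernels of the real derivatives of `f` and of `g`, agree. -/
def IsTangencyPoint (f g : ℂ → ℝ) (z : ℂ) : Prop :=
  f z = 0 ∧ g z = 0 ∧ fderiv ℝ f z ≠ 0 ∧ fderiv ℝ g z ≠ 0 ∧
    (fderiv ℝ f z).ker = (fderiv ℝ g z).ker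

/-- The coefficient of `z ^ 6` in the sextic. -/
def W6 (a b : ℂ) (p : ℝ) : ℂ :=
  4 * conj a * (conj b * b * p - conj b ^ 2 * a - conj a * b ^ 2) * (p ^ 2 - 4 * conj a * a)

/-- The coefficient of `z ^ 5` in the sextic. -/
def W5 (a b : ℂ) (p q : ℝ) : ℂ :=
  -2 * (b * p ^ 5 - conj b * (a + conj a) * p ^ 4 - b * (4 * conj a * q + 8 * conj a * a +
    conj b ^ 2) * p ^ 3 + conj b * (8 * conj a * a * q + 8 * conj a * a ^ 2 + (8 * conj a ^ 2
    + conj b ^ 2) * a - 3 * conj a * b ^ 2) * p ^ 2 + 4 * conj a * b * (4 * conj a * a * q +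
    4 * conj a * a ^ 2 + 4 * conj b ^ 2 * a + conj a * b ^ 2) * p - 4 * a * conj a * conj b *
    (8 * conj a * a * q + 4 * conj a * a ^ 2 + (4 * conj a ^ 2 + 3 * conj b ^ 2) * a +
    3 * conj a * b ^ 2))

/-- The coefficient of `z ^ 4` in the sextic. -/
def W4 (a b : ℂ) (p q : ℝ) : ℂ :=
  -(p ^ 6 - ((4 * a + 4 * conj a) * q + a ^ 2 + 10 * conj a * a - 9 * b ^ 2 + conj a ^ 2 +
    conj b ^ 2) * p ^ 4 - 2 * b * conj b * (2 * q + 11 * a + conj a) * p ^ 3 +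
    (16 * conj a * a * q ^ 2 + 4 * (8 * conj a * a ^ 2 + (8 * conj a ^ 2 + 2 * conj b ^ 2) * a
    - 5 * conj a * b ^ 2) * q + 8 * conj a * a ^ 3 + (32 * conj a ^ 2 +
    14 * conj b ^ 2) * a ^ 2 + (-42 * conj a * b ^ 2 + 8 * conj a ^ 3 +
    18 * conj b ^ 2 * conj a) * a + (-6 * conj a ^ 2 - 5 * conj b ^ 2) * b ^ 2) * p ^ 2 +
    2 * b * conj b * (48 * conj a * a * q + 44 * conj a * a ^ 2 + (4 * conj a ^ 2 +
    7 * conj b ^ 2) * a + conj a * b ^ 2) * p - 64 * conj a ^ 2 * a ^ 2 * q ^ 2 -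
    16 * a ^ 2 * conj a * (4 * conj a * a + 4 * conj a ^ 2 + 7 * conj b ^ 2) * q -
    16 * conj a ^ 2 * a ^ 4 - (32 * conj a ^ 3 + 56 * conj b ^ 2 * conj a) * a ^ 3 +
    (24 * conj a ^ 2 * b ^ 2 - 16 * conj a ^ 4 - 56 * conj b ^ 2 * conj a ^ 2 -
    9 * conj b ^ 4) * a ^ 2 + (24 * conj a ^ 3 - 6 * conj b ^ 2 * conj a) * b ^ 2 * a +
    3 * conj a ^ 2 * b ^ 4)

/-- The coefficient of `z ^ 3` in the sextic. -/
def W3 (a b : ℂ) (p q : ℝ) : ℂ :=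
  -2 * (2 * b * p ^ 5 - conj b * (q + 4 * a) * p ^ 4 - b * ((14 * a + 2 * conj a) * q +
    2 * a ^ 2 + 12 * conj a * a - 8 * b ^ 2 + 2 * conj a ^ 2 + conj b ^ 2) * p ^ 3 + conj b *
    (4 * a * q ^ 2 + (20 * a ^ 2 + 20 * conj a * a - 7 * b ^ 2) * q + 4 * a ^ 3 +
    24 * conj a * a ^ 2 + (-24 * b ^ 2 + 4 * conj a ^ 2 + 3 * conj b ^ 2) * a -
    conj a * b ^ 2) * p ^ 2 + b * (32 * conj a * a * q ^ 2 + (56 * conj a * a ^ 2 +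
    (8 * conj a ^ 2 + 26 * conj b ^ 2) * a - 6 * conj a * b ^ 2) * q + 8 * conj a * a ^ 3 +
    (16 * conj a ^ 2 + 26 * conj b ^ 2) * a ^ 2 + (-18 * conj a * b ^ 2 + 8 * conj a ^ 3 +
    2 * conj b ^ 2 * conj a) * a + (-6 * conj a ^ 2 - conj b ^ 2) * b ^ 2) * p - conj b *
    (80 * conj a * a ^ 2 * q ^ 2 + 4 * a * (20 * conj a * a ^ 2 + (16 * conj a ^ 2 +
    6 * conj b ^ 2) * a - 3 * conj a * b ^ 2) * q + 16 * conj a * a ^ 4 + (32 * conj a ^ 2 +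
    12 * conj b ^ 2) * a ^ 3 + (-28 * conj a * b ^ 2 + 16 * conj a ^ 3 +
    16 * conj b ^ 2 * conj a) * a ^ 2 + (-24 * conj a ^ 2 - conj b ^ 2) * b ^ 2 * a -
    conj a * b ^ 4))

/-- The coefficient of `z ^ 2` in the sextic. -/
def W2 (a b : ℂ) (p q : ℝ) : ℂ :=
  2 * (((3 * a - conj a) * q - 3 * b ^ 2) * p ^ 4 + b * conj b * (3 * q + 9 * a +
    conj a) * p ^ 3 + (-2 * (6 * a ^ 2 + 2 * conj a * a - b ^ 2) * q ^ 2 - (4 * a ^ 3 +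
    16 * conj a * a ^ 2 + (-27 * b ^ 2 - 4 * conj a ^ 2 + 9 * conj b ^ 2) * a +
    4 * conj a * b ^ 2) * q + 3 * (b ^ 2 - 3 * conj b ^ 2) * a ^ 2 + (9 * conj a * b ^ 2 -
    conj b ^ 2 * conj a) * a - 7 * b ^ 4 + 2 * conj a ^ 2 * b ^ 2) * p ^ 2 - b * conj b *
    (28 * a * q ^ 2 + (60 * a ^ 2 - 5 * b ^ 2) * q + 8 * a ^ 3 + 20 * conj a * a ^ 2 -
    (19 * b ^ 2 - 12 * conj a ^ 2) * a - 5 * conj a * b ^ 2) * p + 32 * conj a * a ^ 2 * q ^ 3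
    + 4 * a * (12 * conj a * a ^ 2 + (4 * conj a ^ 2 + 11 * conj b ^ 2) * a -
    3 * conj a * b ^ 2) * q ^ 2 + (16 * conj a * a ^ 4 + (16 * conj a ^ 2 +
    44 * conj b ^ 2) * a ^ 3 + (-32 * conj a * b ^ 2 + 40 * conj b ^ 2 * conj a) * a ^ 2 -
    (12 * conj a ^ 2 + 9 * conj b ^ 2) * b ^ 2 * a + conj a * b ^ 4) * q +
    8 * conj b ^ 2 * a ^ 4 + (-4 * conj a * b ^ 2 + 20 * conj b ^ 2 * conj a) * a ^ 3 +
    (-(4 * conj a ^ 2 + 15 * conj b ^ 2) * b ^ 2 + 12 * conj b ^ 2 * conj a ^ 2 +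
    3 * conj b ^ 4) * a ^ 2 + (5 * conj a * b ^ 4 - 15 * conj b ^ 2 * conj a * b ^ 2) * a +
    2 * conj a ^ 2 * b ^ 4)

/-- The coefficient of `z ^ 1` in the sextic. -/
def W1 (a b : ℂ) (p q : ℝ) : ℂ :=
  2 * (2 * b * (q ^ 2 + (3 * a - conj a) * q - b ^ 2) * p ^ 3 - conj b * (8 * a * q ^ 2 +
    (12 * a ^ 2 - 4 * conj a * a + b ^ 2) * q - 6 * b ^ 2 * a - 2 * conj a * b ^ 2) * p ^ 2 -
    b * (8 * a * q ^ 3 + (32 * a ^ 2 - 8 * conj a * a - 2 * b ^ 2) * q ^ 2 + (8 * a ^ 3 +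
    8 * conj a * a ^ 2 + (-20 * b ^ 2 - 2 * conj b ^ 2) * a + 2 * conj a * b ^ 2) * q +
    (-2 * b ^ 2 + 6 * conj b ^ 2) * a ^ 2 + (-2 * conj a * b ^ 2 +
    6 * conj b ^ 2 * conj a) * a + 3 * b ^ 4 - conj b ^ 2 * b ^ 2) * p + conj b *
    (32 * a ^ 2 * q ^ 3 + 4 * a * (12 * a ^ 2 + 4 * conj a * a - 3 * b ^ 2) * q ^ 2 +
    (16 * a ^ 4 + 16 * conj a * a ^ 3 + (-32 * b ^ 2 + 8 * conj b ^ 2) * a ^ 2 -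
    12 * conj a * b ^ 2 * a + b ^ 4) * q + (-4 * b ^ 2 + 4 * conj b ^ 2) * a ^ 3 +
    (-4 * conj a * b ^ 2 + 4 * conj b ^ 2 * conj a) * a ^ 2 + (5 * b ^ 4 -
    3 * conj b ^ 2 * b ^ 2) * a + 2 * conj a * b ^ 4))

/-- The coefficient of `z ^ 0` in the sextic. -/
def W0 (a b : ℂ) (p q : ℝ) : ℂ :=
  q ^ 2 * p ^ 4 - 2 * conj b * b * q * p ^ 3 + (-8 * a * q ^ 3 + (-8 * a ^ 2 +
    2 * b ^ 2) * q ^ 2 + (6 * b ^ 2 + 2 * conj b ^ 2) * a * q - b ^ 4 +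
    conj b ^ 2 * b ^ 2) * p ^ 2 + 2 * b * conj b * (4 * a * q ^ 2 + (-4 * a ^ 2 - b ^ 2) * q +
    (b ^ 2 - conj b ^ 2) * a) * p + 16 * a ^ 2 * q ^ 4 + 8 * a * (4 * a ^ 2 - b ^ 2) * q ^ 3 +
    (16 * a ^ 4 + (-32 * b ^ 2 + 8 * conj b ^ 2) * a ^ 2 + b ^ 4) * q ^ 2 - 2 * a *
    ((4 * b ^ 2 - 4 * conj b ^ 2) * a ^ 2 - 5 * b ^ 4 + 3 * conj b ^ 2 * b ^ 2) * q + (b -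
    conj b) * (b + conj b) * ((b ^ 2 - conj b ^ 2) * a ^ 2 - b ^ 4)

/-- The polynomial `F₄ = W₆ z⁶ + W₅ z⁵ + W₄ z⁴ + W₃ z³ + W₂ z² + W₁ z + W₀`. -/
def F4 (a b : ℂ) (p q : ℝ) : Polynomial ℂ :=
  Polynomial.C (W6 a b p) * Polynomial.X ^ 6 + Polynomial.C (W5 a b p q) * Polynomial.X ^ 5
    + Polynomial.C (W4 a b p q) * Polynomial.X ^ 4 + Polynomial.C (W3 a b p q) * Polynomial.X ^ 3
    + Polynomial.C (W2 a b p q) * Polynomial.X ^ 2 + Polynomial.C (W1 a b p q) * Polynomial.X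
    + Polynomial.C (W0 a b p q)

end Alhazen

end

open scoped ComplexConjugate

namespace Alhazen

/-! Treat `z` and `w = conj z` as independent variables. Tangency makes the gradients parallel, `c_z
e_w = c_w e_z`. On `E`, `e_w²` and `e_z²` equal the discriminants of `e` in `w` and in `z`, which
are the same constant times `z² - 1` and `w² - 1`. Squaring and cancelling that constant removes
`r`: `c_z² (z² - 1) = c_w² (w² - 1)`. On `C`, moreover, `c_w²` equals `D`, which does not involve
`w`; this lowers the relation from degree four to degree two in `w`. Thus `conj z` is a common root
of two quadratics in `w` whose coefficients are polynomials in `z`, and their resultant is exactly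
`F₄`. -/

/-- The value of `F₄` is the resultant, with respect to `w`, of the conic
`c = A z² + p z w + a w² + B z + b w + q` and of `c_z² (z² - 1) - D (w² - 1)`, where
`D = c_w² - 4 a c` is the discriminant of `c` in `w`. -/
theorem eval_F4_eq_resultant (a b : ℂ) (p q : ℝ) (z : ℂ) :
    (F4 a b p q).eval z =
      (a * ((2 * conj a * z + conj b) ^ 2 * (z ^ 2 - 1)
            + ((p * z + b) ^ 2 - 4 * a * (conj a * z ^ 2 + conj b * z + q)))
        - (conj a * z ^ 2 + conj b * z + q) * (p ^ 2 * (z ^ 2 - 1)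
            - ((p * z + b) ^ 2 - 4 * a * (conj a * z ^ 2 + conj b * z + q)))) ^ 2
      - (a * (2 * p * (2 * conj a * z + conj b) * (z ^ 2 - 1))
          - (p * z + b) * (p ^ 2 * (z ^ 2 - 1)
            - ((p * z + b) ^ 2 - 4 * a * (conj a * z ^ 2 + conj b * z + q))))
        * ((p * z + b) * ((2 * conj a * z + conj b) ^ 2 * (z ^ 2 - 1)
            + ((p * z + b) ^ 2 - 4 * a * (conj a * z ^ 2 + conj b * z + q)))
          - (conj a * z ^ 2 + conj b * z + q)
            * (2 * p * (2 * conj a * z + conj b) * (z ^ 2 - 1))) := by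
  simp only [F4, Polynomial.eval_add, Polynomial.eval_mul, Polynomial.eval_C,
    Polynomial.eval_pow, Polynomial.eval_X]
  unfold W6 W5 W4 W3 W2 W1 W0
  -- The identity is formal: it holds with the conjugates as independent variables.
  generalize conj a = A
  generalize conj b = B
  generalize (p : ℂ) = P
  generalize (q : ℂ) = Q
  ring

/-- The Sylvester resultant of two quadratic polynomials vanishes if they have a common root. -/
theorem quadratic_resultant_eq_zero {R : Type*} [CommRing R] {c₂ c₁ c₀ h₂ h₁ h₀ w : R}
    (hc : c₂ * w ^ 2 + c₁ * w + c₀ = 0) (hh : h₂ * w ^ 2 + h₁ * w + h₀ = 0) :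
    (c₂ * h₀ - c₀ * h₂) ^ 2 - (c₂ * h₁ - c₁ * h₂) * (c₁ * h₀ - c₀ * h₁) = 0 := by
  -- Eliminate `w²` here and `w` in `h2`. Nothing is divided, so the leading coefficients may
  -- vanish.
  have h1 : c₂ * h₀ - c₀ * h₂ = -(c₂ * h₁ - c₁ * h₂) * w := by
    linear_combination c₂ * hh - h₂ * hc
  have h2 : c₁ * h₀ - c₀ * h₁ = (c₂ * h₁ - c₁ * h₂) * w ^ 2 := by
    linear_combination c₁ * hh - h₁ * hc
  rw [h1, h2]
  ring

/-- The real derivative of `conicFun` is `v ↦ 2 Re (c_z v)`. -/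
theorem fderiv_conicFun_apply (a b : ℂ) (p q : ℝ) (z v : ℂ) :
    fderiv ℝ (conicFun a b p q) z v =
      2 * ((2 * conj a * z + p * conj z + conj b) * v).re := by
  have hid : HasFDerivAt (fun z : ℂ => z) (ContinuousLinearMap.id ℝ ℂ) z := hasFDerivAt_id z
  have hconj : HasFDerivAt (fun z : ℂ => conj z) (Complex.conjCLE : ℂ →L[ℝ] ℂ) z :=
    Complex.conjCLE.hasFDerivAt
  have h := Complex.reCLM.hasFDerivAt.comp z
    ((((((hid.pow 2).const_mul (conj a)).add ((hid.const_mul (p : ℂ)).mul hconj)).add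
      ((hconj.pow 2).const_mul a)).add (hid.const_mul (conj b))).add
        (hconj.const_mul b) |>.add_const (q : ℂ))
  have h' : HasFDerivAt (conicFun a b p q) _ z := h
  rw [h'.fderiv]
  simp [Complex.mul_re, Complex.mul_im]
  ring

/-- This lets the derivative formula for conics serve both curves. -/
theorem ellipseFun_eq_conicFun (r : ℝ) :
    ellipseFun r =
      conicFun 1 0 (2 - 2 * (r ^ 2 / 2)) ((r ^ 2 / 2) ^ 2 - 2 * (r ^ 2 / 2)) := by
  funext z
  apply Complex.ofReal_injective
  rw [ellipseFun_coe, conicFun_coe]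
  push_cast
  simp only [map_one, map_zero]
  ring

/-- At a tangency point of two conics the gradients are parallel, in the complex form
`c_z e_w = c_w e_z`. -/
theorem IsTangencyPoint.gradients_parallel {a b a' b' : ℂ} {p q p' q' : ℝ} {z : ℂ}
    (h : IsTangencyPoint (conicFun a b p q) (conicFun a' b' p' q') z) :
    (2 * conj a * z + p * conj z + conj b) * (p' * z + 2 * a' * conj z + b') =
      (p * z + 2 * a * conj z + b) * (2 * conj a' * z + p' * conj z + conj b') := by
  obtain ⟨-, -, -, -, hker⟩ := h
  set m : ℂ := 2 * conj a * z + p * conj z + conj b with hm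
  set n : ℂ := 2 * conj a' * z + p' * conj z + conj b' with hn
  have hm' : p * z + 2 * a * conj z + b = conj m := by
    simp only [hm, map_add, map_mul, map_ofNat, Complex.conj_conj, Complex.conj_ofReal]; ring
  have hn' : p' * z + 2 * a' * conj z + b' = conj n := by
    simp only [hn, map_add, map_mul, map_ofNat, Complex.conj_conj, Complex.conj_ofReal]; ring
  -- The gradient direction `conj m` turned by a right angle is tangent to the first curve. Feeding
  -- it to the second derivative gives `Im (n * conj m) = 0`, so `m * conj n` is real, which is the
  -- claim.
  have hmem : Complex.I * conj m ∈ (fderiv ℝ (conicFun a b p q) z).ker := by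
    change fderiv ℝ (conicFun a b p q) z _ = 0
    rw [fderiv_conicFun_apply, ← hm]
    simp [Complex.mul_re, Complex.mul_im]
    ring
  rw [hker] at hmem
  have h0 : fderiv ℝ (conicFun a' b' p' q') z (Complex.I * conj m) = 0 := hmem
  rw [fderiv_conicFun_apply, ← hn] at h0
  simp [Complex.mul_re, Complex.mul_im] at h0
  rw [hm', hn']
  apply Complex.ext
  · simp [Complex.mul_re]
  · simp [Complex.mul_im]; linarith

/-- A tangency condition with the confocal family `E`, free of the parameter `r`. -/
theorem IsTangencyPoint.sq_mul_sub_one_eq {a b : ℂ} {p q r : ℝ} (hr : 2 < r) {z : ℂ}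
    (h : IsTangencyPoint (conicFun a b p q) (ellipseFun r) z) :
    (2 * conj a * z + p * conj z + conj b) ^ 2 * (z ^ 2 - 1) =
      (p * z + 2 * a * conj z + b) ^ 2 * (conj z ^ 2 - 1) := by
  have he : (ellipseFun r z : ℂ) = 0 := by rw [h.2.1, Complex.ofReal_zero]
  rw [ellipseFun_coe] at he
  rw [ellipseFun_eq_conicFun] at h
  have hpar := h.gradients_parallel
  -- This is the constant to be cancelled. It factors as `s (s - 2)` with `s = r² / 2`, and `r > 2`
  -- gives `s > 2`.
  have hs : ((r ^ 2 / 2 : ℝ) : ℂ) ^ 2 - 2 * ((r ^ 2 / 2 : ℝ) : ℂ) ≠ 0 := by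
    have : (r ^ 2 / 2) ^ 2 - 2 * (r ^ 2 / 2) ≠ 0 := by
      have h2 : 2 < r ^ 2 / 2 := by nlinarith
      have : 0 < (r ^ 2 / 2) * (r ^ 2 / 2 - 2) := by
        apply mul_pos <;> linarith
      nlinarith
    exact_mod_cast this
  simp only [Complex.ofReal_sub, Complex.ofReal_mul, Complex.ofReal_ofNat, map_one,
    map_zero] at hpar
  generalize ((r ^ 2 / 2 : ℝ) : ℂ) = s at he hs hpar
  generalize conj z = w at *
  generalize conj a = A at *
  generalize conj b = B at *
  generalize (p : ℂ) = P at *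
  set m := 2 * A * z + P * w + B
  set n := P * z + 2 * a * w + b
  -- A quadratic's derivative, squared at a root, is its discriminant: `e_w²` here, `e_z²` in `hz`.
  have hw : ((2 - 2 * s) * z + 2 * w) ^ 2 = 4 * (s ^ 2 - 2 * s) * (z ^ 2 - 1) := by
    linear_combination 4 * he
  have hz : (2 * z + (2 - 2 * s) * w) ^ 2 = 4 * (s ^ 2 - 2 * s) * (w ^ 2 - 1) := by
    linear_combination 4 * he
  have hpar' : m * ((2 - 2 * s) * z + 2 * w) = n * (2 * z + (2 - 2 * s) * w) := by
    linear_combination hpar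
  have hsq := congrArg (· ^ 2) hpar'
  simp only [mul_pow _ _ 2] at hsq
  apply mul_left_cancel₀ (mul_ne_zero (by norm_num : (4 : ℂ) ≠ 0) hs)
  linear_combination hsq - m ^ 2 * hw + n ^ 2 * hz

end Alhazen

theorem theorem4p1 (a b : ℂ) (p q : ℝ) (hC : Alhazen.IsNondegenerateConic a b p q)
    (r : ℝ) (hr : 2 < r) (hE : Alhazen.confocalEllipse r ≠ Alhazen.conic a b p q)
    (z : ℂ)
    (hz : Alhazen.IsTangencyPoint (Alhazen.conicFun a b p q) (Alhazen.ellipseFun r) z) :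
    (Alhazen.F4 a b p q).IsRoot z := by
  have hc : (Alhazen.conicFun a b p q z : ℂ) = 0 := by rw [hz.1, Complex.ofReal_zero]
  rw [Alhazen.conicFun_coe] at hc
  have ht := hz.sq_mul_sub_one_eq hr
  rw [Polynomial.IsRoot.def, Alhazen.eval_F4_eq_resultant]
  apply Alhazen.quadratic_resultant_eq_zero (w := conj z)
  · linear_combination hc
  -- The multiple of `hc` replaces `c_w²` by `D`, since `c_w² = D + 4 a c`.
  · linear_combination ht + 4 * a * (conj z ^ 2 - 1) * hc
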